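/- Let $\mathcal H$ be a real Hilbert space, let $M_1,\dots,M_m$ be closed linear subspaces of $\mathcal H$, and put $M:=\bigcap_{i=1}^m M_i$ and $T:=P_{M_m}\cdots P_{M_1}$, where $P_K$ denotes the orthogonal projection onto a closed subspace $K$. For $y_0\in\mathcal H$ let $y_k:=T^k y_0$, $k=1,2,\dots$. For $p=1,2,\dots$ let $X_p:=M\oplus (I-T)^p(\mathcal H)$, and let $Y:=M\oplus\sum_{i=1}^m M_i^\perp$, where $\sum_{i=1}^m M_i^\perp$ is the algebraic sum. Assume that $\sum_{i=1}^m M_i^\perp$ is not closed. Then for every $p\in\{1,2,\dots\}$ and every $\varepsilon>0$ it is not true that $\|y_k-P_M y_0\|=o(k^{-(p+\varepsilon)})$ as $k\to\infty$ for all $y_0\in X_p$ (thus, in the rate $\|y_k-P_M y_0\|=o(k^{-p})$, known to hold for all $y_0\in X_p$, the polynomial $k^p$ cannot be replaced by $k^{p+\varepsilon}$). Moreover, $X_{p+1}\subsetneq X_p\subsetneq Y$ for every $p=1,2,\dots$. -/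

import Mathlib

open Filter Asymptotics

noncomputable section

namespace CyclicProjections

variable {H : Type*} [NormedAddCommGroup H] [InnerProductSpace ℝ H] [CompleteSpace H] {m : ℕ}

/-- The orthogonal projection `P_K : H → H` onto a closed subspace `K`. -/
def proj (K : ClosedSubmodule ℝ H) : H →L[ℝ] H :=
  K.toSubmodule.starProjection

/-- The intersection `M = M_1 ∩ ⋯ ∩ M_m`. -/
def inter (M : Fin m → ClosedSubmodule ℝ H) : ClosedSubmodule ℝ H :=
  ⨅ i, M i

/-- The product `T = P_{M_m} ⋯ P_{M_1}`; the projection onto the first subspace acts first. -/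
def T (M : Fin m → ClosedSubmodule ℝ H) : H →L[ℝ] H :=
  (List.ofFn fun i => proj (M i)).reverse.prod

/-- The iterates `y_k = T^k y_0` of the method of cyclic projections. -/
def iter (M : Fin m → ClosedSubmodule ℝ H) (y₀ : H) (k : ℕ) : H :=
  (T M ^ k) y₀

/-- The algebraic sum `M_1^⊥ + ⋯ + M_m^⊥` (a supremum of plain submodules, with no closure). -/
def sumPerp (M : Fin m → ClosedSubmodule ℝ H) : Submodule ℝ H :=
  ⨆ i, (M i).toSubmoduleᗮ

/-- The range `(I - T)^p (H)`. -/
def rangePow (M : Fin m → ClosedSubmodule ℝ H) (p : ℕ) : Submodule ℝ H :=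
  LinearMap.range ((1 - T M) ^ p : H →L[ℝ] H).toLinearMap

/-- `X_p = M ⊕ (I - T)^p (H)`; the sum is orthogonal for `p ≥ 1`, see `inter_isOrtho_rangePow`. -/
def X (M : Fin m → ClosedSubmodule ℝ H) (p : ℕ) : Submodule ℝ H :=
  (inter M).toSubmodule ⊔ rangePow M p

/-- `Y = M ⊕ (M_1^⊥ + ⋯ + M_m^⊥)`; the sum is orthogonal, see `inter_isOrtho_sumPerp`. -/
def Y (M : Fin m → ClosedSubmodule ℝ H) : Submodule ℝ H :=
  (inter M).toSubmodule ⊔ sumPerp M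

/-- The sum defining `Y` is an orthogonal direct sum. -/
theorem inter_isOrtho_sumPerp (M : Fin m → ClosedSubmodule ℝ H) :
    (inter M).toSubmodule ⟂ sumPerp M := by
  rw [sumPerp, Submodule.isOrtho_iSup_right]
  intro i
  refine (Submodule.isOrtho_orthogonal_right (M i).toSubmodule).mono_left ?_
  exact ClosedSubmodule.toSubmodule_le_toSubmodule.2 (iInf_le M i)

/-- The sum defining `X_p`, `p ≥ 1`, is an orthogonal direct sum. -/
theorem inter_isOrtho_rangePow (M : Fin m → ClosedSubmodule ℝ H) {p : ℕ} (hp : 1 ≤ p) :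
    (inter M).toSubmodule ⟂ rangePow M p := by
  have key : ∀ L : List (H →L[ℝ] H), (∀ Q ∈ L, ∃ i, Q = proj (M i)) →
      ∀ x ∈ inter M, ∀ z : H, inner ℝ x (L.prod z) = inner ℝ x z := by
    intro L
    induction L with
    | nil => intro _ x _ z; simp
    | cons Q L ih =>
      intro h x hx z
      obtain ⟨i, rfl⟩ := h Q (by simp)
      have hxi : x ∈ (M i).toSubmodule := (ClosedSubmodule.mem_iInf.1 hx) i
      rw [List.prod_cons, mul_apply_eq_comp, proj,
        ← Submodule.inner_starProjection_left_eq_right,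
        Submodule.starProjection_eq_self_iff.2 hxi]
      exact ih (fun Q hQ => h Q (by simp [hQ])) x hx z
  rw [Submodule.isOrtho_iff_inner_eq]
  rintro x hx _ ⟨z, rfl⟩
  obtain ⟨q, rfl⟩ := Nat.exists_eq_add_of_le hp
  have h := key (List.ofFn fun i => proj (M i)).reverse
    (fun Q hQ => by
      obtain ⟨i, hi⟩ := List.mem_ofFn.1 (List.mem_reverse.1 hQ)
      exact ⟨i, hi.symm⟩) x hx (((1 - T M) ^ q) z)
  change inner ℝ x (((1 - T M) ^ (1 + q)) z) = 0
  rw [pow_add, pow_one, mul_apply_eq_comp, sub_apply,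
    one_apply_eq_self, inner_sub_right, sub_eq_zero]
  exact h.symm

end CyclicProjections

end

namespace CyclicProjections

variable {H : Type*} [NormedAddCommGroup H] [InnerProductSpace ℝ H] [CompleteSpace H] {m : ℕ}

/-! Since (I - T)(H) ⊆ ∑ M_i^⊥ ⊆ M^⊥, the sum is closed as soon as I - T maps onto M^⊥; each claim
is proved by deriving this surjectivity from its failure. If X_{p+1} = X_p, cancel (I - T)^p, which
is injective on M^⊥. If X_p = Y, then ∑ M_i^⊥ ⊆ (I - T)(H); the closed graph theorem bounds x by any
splitting of (I - T)x, and `exists_sum_eq_sub_listProj` bounds one such splitting by the norm lost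
under T, so T is a strict contraction on M^⊥. If the faster rate held on X_p, summing tails p times
would give ‖T^k z‖ = O(k^{-ε}) on M^⊥, and uniform boundedness makes some T^k a strict contraction
there. `orthogonal_le_rangePow_one` concludes in the last two cases. -/

/-! ### Products of projections and loss of norm -/

theorem proj_eq_self {K : ClosedSubmodule ℝ H} {x : H} (hx : x ∈ K.toSubmodule) :
    proj K x = x :=
  Submodule.starProjection_eq_self_iff.2 hx

theorem norm_proj_le (K : ClosedSubmodule ℝ H) (x : H) : ‖proj K x‖ ≤ ‖x‖ :=
  K.toSubmodule.norm_starProjection_apply_le x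

theorem sub_proj_mem_orthogonal (K : ClosedSubmodule ℝ H) (x : H) :
    x - proj K x ∈ K.toSubmoduleᗮ :=
  Submodule.sub_starProjection_mem_orthogonal x

theorem norm_sq_sub_norm_sq_proj (K : ClosedSubmodule ℝ H) (x : H) :
    ‖x - proj K x‖ ^ 2 = ‖x‖ ^ 2 - ‖proj K x‖ ^ 2 := by
  have h := Submodule.norm_sq_eq_add_norm_sq_starProjection x K.toSubmodule
  rw [Submodule.starProjection_orthogonal_val] at h
  rw [proj]
  linarith

/-- The product of the projections indexed by a list; the last entry of the list acts first. -/
noncomputable def listProj (M : Fin m → ClosedSubmodule ℝ H) (l : List (Fin m)) : H →L[ℝ] H :=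
  (l.map fun i => proj (M i)).prod

theorem listProj_cons (M : Fin m → ClosedSubmodule ℝ H) (i : Fin m) (l : List (Fin m)) (x : H) :
    listProj M (i :: l) x = proj (M i) (listProj M l x) := by
  simp [listProj]

theorem listProj_nil (M : Fin m → ClosedSubmodule ℝ H) (x : H) : listProj M [] x = x := by
  simp [listProj]

theorem T_eq_listProj (M : Fin m → ClosedSubmodule ℝ H) :
    T M = listProj M (List.finRange m).reverse := by
  rw [T, listProj, List.ofFn_eq_map, List.map_reverse]

theorem norm_listProj_le (M : Fin m → ClosedSubmodule ℝ H) (l : List (Fin m)) (x : H) :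
    ‖listProj M l x‖ ≤ ‖x‖ := by
  induction l with
  | nil => simp [listProj_nil]
  | cons i l ih => rw [listProj_cons]; exact (norm_proj_le _ _).trans ih

theorem listProj_eq_self (M : Fin m → ClosedSubmodule ℝ H) (l : List (Fin m)) {x : H}
    (hx : ∀ i ∈ l, x ∈ (M i).toSubmodule) : listProj M l x = x := by
  induction l with
  | nil => exact listProj_nil M x
  | cons i l ih =>
    rw [listProj_cons, ih fun j hj => hx j (by simp [hj]), proj_eq_self (hx i (by simp))]

/-- No factor increases the norm, so none may decrease it, and a projection preserves the norm only
on its range. -/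
theorem mem_of_norm_listProj_eq (M : Fin m → ClosedSubmodule ℝ H) (l : List (Fin m)) {x : H}
    (hx : ‖listProj M l x‖ = ‖x‖) : ∀ i ∈ l, x ∈ (M i).toSubmodule := by
  induction l with
  | nil => simp
  | cons i l ih =>
    rw [listProj_cons] at hx
    have h1 : ‖listProj M l x‖ = ‖x‖ :=
      le_antisymm (norm_listProj_le M l x) (hx ▸ norm_proj_le _ _)
    have h2 := ih h1
    rw [listProj_eq_self M l h2] at hx
    intro j hj
    rcases List.mem_cons.1 hj with rfl | hj
    · exact (Submodule.mem_iff_norm_starProjection _ x).2 hx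
    · exact h2 j hj

/-- `x - P_l x` splits along the `M_i^⊥`, with components controlled by the loss of norm. -/
theorem exists_sum_eq_sub_listProj (M : Fin m → ClosedSubmodule ℝ H) (l : List (Fin m)) :
    ∃ C : ℝ, 0 < C ∧ ∀ x : H, ∃ u : ∀ i, (M i).toSubmoduleᗮ,
      x - listProj M l x = ∑ i, (u i : H) ∧ ‖u‖ ^ 2 ≤ C * (‖x‖ ^ 2 - ‖listProj M l x‖ ^ 2) := by
  induction l with
  | nil => exact ⟨1, one_pos, fun x => ⟨0, by simp [listProj_nil]⟩⟩
  | cons i l ih =>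
    obtain ⟨C, hC, h⟩ := ih
    -- From (a + b)² ≤ 2a² + 2b²; the norm losses of successive projections add up.
    refine ⟨2 * C + 2, by positivity, fun x => ?_⟩
    obtain ⟨u, hu, hn⟩ := h x
    set y := listProj M l x with hy
    let w : (M i).toSubmoduleᗮ := ⟨y - proj (M i) y, sub_proj_mem_orthogonal _ _⟩
    refine ⟨u + Pi.single i w, ?_, ?_⟩
    · have hs : ∑ j, ((Pi.single i w : ∀ j, (M j).toSubmoduleᗮ) j : H) = w := by
        rw [Finset.sum_eq_single i]
        · simp
        · intro j _ hj
          simp [Pi.single_eq_of_ne hj]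
        · simp
      simp only [Pi.add_apply, Submodule.coe_add, Finset.sum_add_distrib, hs]
      rw [← hu, listProj_cons, ← hy]
      simp [w]
    · rw [listProj_cons, ← hy]
      have hw : ‖w‖ ^ 2 = ‖y‖ ^ 2 - ‖proj (M i) y‖ ^ 2 := norm_sq_sub_norm_sq_proj (M i) y
      have h1 : ‖u + Pi.single i w‖ ≤ ‖u‖ + ‖w‖ :=
        (norm_add_le _ _).trans_eq (by rw [Pi.norm_single])
      have h2 : ‖u + Pi.single i w‖ ^ 2 ≤ (‖u‖ + ‖w‖) ^ 2 := by gcongr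
      have h3 : ‖y‖ ^ 2 ≤ ‖x‖ ^ 2 := by
        gcongr
        exact norm_listProj_le M l x
      nlinarith [sq_nonneg (‖u‖ - ‖w‖), sq_nonneg ‖w‖]

/-! ### Fixed points of T and the range of I - T -/

theorem mem_inter_iff (M : Fin m → ClosedSubmodule ℝ H) {x : H} :
    x ∈ (inter M).toSubmodule ↔ ∀ i, x ∈ (M i).toSubmodule :=
  ClosedSubmodule.mem_iInf

theorem T_apply_eq_self_iff (M : Fin m → ClosedSubmodule ℝ H) {x : H} :
    T M x = x ↔ x ∈ (inter M).toSubmodule := by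
  rw [mem_inter_iff, T_eq_listProj]
  refine ⟨fun h i => ?_, fun h => listProj_eq_self M _ fun i _ => h i⟩
  exact mem_of_norm_listProj_eq M _ (by rw [h]) i (by simp)

theorem norm_T_pow_le (M : Fin m → ClosedSubmodule ℝ H) (k : ℕ) (x : H) :
    ‖(T M ^ k) x‖ ≤ ‖x‖ := by
  induction k with
  | zero => simp
  | succ k ih =>
    rw [pow_succ', mul_apply_eq_comp]
    refine le_trans ?_ ih
    rw [T_eq_listProj]
    exact norm_listProj_le M _ _

theorem rangePow_le_orthogonal (M : Fin m → ClosedSubmodule ℝ H) {p : ℕ} (hp : 1 ≤ p) :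
    rangePow M p ≤ (inter M).toSubmoduleᗮ :=
  (inter_isOrtho_rangePow M hp).symm

theorem sumPerp_le_orthogonal (M : Fin m → ClosedSubmodule ℝ H) :
    sumPerp M ≤ (inter M).toSubmoduleᗮ :=
  (inter_isOrtho_sumPerp M).symm

theorem mem_rangePow_one (M : Fin m → ClosedSubmodule ℝ H) {y : H} :
    y ∈ rangePow M 1 ↔ ∃ x, x - T M x = y := by
  simp [rangePow]

theorem rangePow_one_le_sumPerp (M : Fin m → ClosedSubmodule ℝ H) : rangePow M 1 ≤ sumPerp M := by
  intro y hy
  obtain ⟨x, rfl⟩ := (mem_rangePow_one M).1 hy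
  obtain ⟨C, -, h⟩ := exists_sum_eq_sub_listProj M (List.finRange m).reverse
  obtain ⟨u, hu, -⟩ := h x
  rw [T_eq_listProj, hu]
  exact Submodule.sum_mem _ fun i _ => Submodule.mem_iSup_of_mem i (u i).2

theorem isClosed_sumPerp_of_orthogonal_le (M : Fin m → ClosedSubmodule ℝ H)
    (h : (inter M).toSubmoduleᗮ ≤ rangePow M 1) : IsClosed (sumPerp M : Set H) := by
  rw [le_antisymm (sumPerp_le_orthogonal M) (h.trans (rangePow_one_le_sumPerp M))]
  exact Submodule.isClosed_orthogonal _

theorem T_mem_orthogonal (M : Fin m → ClosedSubmodule ℝ H) {x : H}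
    (hx : x ∈ (inter M).toSubmoduleᗮ) : T M x ∈ (inter M).toSubmoduleᗮ := by
  have h : x - T M x ∈ (inter M).toSubmoduleᗮ :=
    rangePow_le_orthogonal M le_rfl ((mem_rangePow_one M).2 ⟨x, rfl⟩)
  simpa using Submodule.sub_mem _ hx h

theorem T_pow_mem_orthogonal (M : Fin m → ClosedSubmodule ℝ H) (k : ℕ) {x : H}
    (hx : x ∈ (inter M).toSubmoduleᗮ) : (T M ^ k) x ∈ (inter M).toSubmoduleᗮ := by
  induction k with
  | zero => simpa
  | succ k ih =>
    rw [pow_succ', mul_apply_eq_comp]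
    exact T_mem_orthogonal M ih

theorem sub_T_pow_mem_rangePow_one (M : Fin m → ClosedSubmodule ℝ H) (k : ℕ) (x : H) :
    x - (T M ^ k) x ∈ rangePow M 1 := by
  refine (mem_rangePow_one M).2 ⟨(∑ i ∈ Finset.range k, T M ^ i) x, ?_⟩
  have h := congrArg (fun A : H →L[ℝ] H => A x) (mul_neg_geom_sum (T M) k)
  simpa only [mul_apply_eq_comp, sub_apply, one_apply_eq_self] using h

theorem eq_zero_of_mem_inter_of_mem_orthogonal (M : Fin m → ClosedSubmodule ℝ H) {x : H}
    (hx : x ∈ (inter M).toSubmodule) (hx' : x ∈ (inter M).toSubmoduleᗮ) : x = 0 :=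
  Submodule.disjoint_def.1 (Submodule.orthogonal_disjoint _) x hx hx'

theorem proj_inter_eq_zero (M : Fin m → ClosedSubmodule ℝ H) {x : H}
    (hx : x ∈ (inter M).toSubmoduleᗮ) : proj (inter M) x = 0 :=
  (Submodule.starProjection_apply_eq_zero_iff _).2 hx

/-- A Neumann series argument: if some power of `T` is a strict contraction on `M^⊥`, then `I - T`
maps onto `M^⊥`. -/
theorem orthogonal_le_rangePow_one (M : Fin m → ClosedSubmodule ℝ H) {k : ℕ}
    (h : ‖(T M ^ k) * (1 - proj (inter M))‖ < 1) : (inter M).toSubmoduleᗮ ≤ rangePow M 1 := by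
  intro y hy
  obtain ⟨A, hA⟩ := isUnit_one_sub_of_norm_lt_one h
  let x : H := (↑A⁻¹ : H →L[ℝ] H) y
  have hx : x - (T M ^ k) (x - proj (inter M) x) = y := by
    have h1 := congrArg (fun B : H →L[ℝ] H => B y) A.mul_inv
    rw [hA] at h1
    simpa using h1
  have hperp : x - proj (inter M) x ∈ (inter M).toSubmoduleᗮ := sub_proj_mem_orthogonal _ _
  -- By `hx`, x is a sum of two vectors of M^⊥, so the correction by P_M vanishes.
  have hxp : x ∈ (inter M).toSubmoduleᗮ := by
    have := Submodule.add_mem _ hy (T_pow_mem_orthogonal M k hperp)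
    rwa [← hx, sub_add_cancel] at this
  rw [proj_inter_eq_zero M hxp, sub_zero] at hx
  exact hx ▸ sub_T_pow_mem_rangePow_one M k x

/-- The kernel of I - T is M, and I - T maps H into M^⊥, so factors can be cancelled one at a time.
-/
theorem mem_inter_of_one_sub_T_pow_eq_zero (M : Fin m → ClosedSubmodule ℝ H) (p : ℕ) (x : H)
    (hx : x ∈ (inter M).toSubmoduleᗮ) (h : ((1 - T M) ^ p) x = 0) : x = 0 := by
  induction p generalizing x with
  | zero => simpa using h
  | succ p ih =>
    rw [pow_succ, mul_apply_eq_comp] at h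
    have h1 : (1 - T M) x = 0 :=
      ih _ (rangePow_le_orthogonal M le_rfl ⟨x, by simp⟩) h
    refine eq_zero_of_mem_inter_of_mem_orthogonal M ((T_apply_eq_self_iff M).1 ?_) hx
    rw [sub_apply, one_apply_eq_self] at h1
    exact (sub_eq_zero.1 h1).symm

/-! ### Strictness of the inclusions -/

theorem rangePow_succ_le (M : Fin m → ClosedSubmodule ℝ H) (p : ℕ) :
    rangePow M (p + 1) ≤ rangePow M p := by
  rintro _ ⟨x, rfl⟩
  exact ⟨(1 - T M) x, by simp [pow_succ]⟩

theorem X_succ_le (M : Fin m → ClosedSubmodule ℝ H) (p : ℕ) : X M (p + 1) ≤ X M p :=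
  sup_le_sup_left (rangePow_succ_le M p) _

theorem mem_of_mem_sup_of_mem_orthogonal (M : Fin m → ClosedSubmodule ℝ H) {K : Submodule ℝ H}
    (hK : K ≤ (inter M).toSubmoduleᗮ) {y : H} (hy : y ∈ (inter M).toSubmodule ⊔ K)
    (hy' : y ∈ (inter M).toSubmoduleᗮ) : y ∈ K := by
  obtain ⟨a, ha, b, hb, rfl⟩ := Submodule.mem_sup.1 hy
  have : a = 0 := eq_zero_of_mem_inter_of_mem_orthogonal M ha
    (by simpa using Submodule.sub_mem _ hy' (hK hb))
  simpa [this] using hb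

theorem X_succ_lt (M : Fin m → ClosedSubmodule ℝ H) (hM : ¬ IsClosed (sumPerp M : Set H))
    {p : ℕ} (hp : 1 ≤ p) : X M (p + 1) < X M p := by
  refine lt_of_le_not_ge (X_succ_le M p) fun hle => hM ?_
  refine isClosed_sumPerp_of_orthogonal_le M fun x hx => ?_
  have hxp : ((1 - T M) ^ p) x ∈ rangePow M p := ⟨x, rfl⟩
  obtain ⟨z, hz⟩ := mem_of_mem_sup_of_mem_orthogonal M
    (rangePow_le_orthogonal M (Nat.le_add_left 1 p)) (hle (Submodule.mem_sup_right hxp))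
    (rangePow_le_orthogonal M hp hxp)
  have hSz : (1 - T M) z ∈ rangePow M 1 := ⟨z, by simp⟩
  have h0 : x - (1 - T M) z = 0 := by
    refine mem_inter_of_one_sub_T_pow_eq_zero M p _
      (Submodule.sub_mem _ hx (rangePow_le_orthogonal M le_rfl hSz)) ?_
    rw [map_sub, sub_eq_zero, ← hz, pow_succ]
    rfl
  rwa [sub_eq_zero.1 h0]

/-- If `M_1^⊥ + ⋯ + M_m^⊥` lies in the range of `I - T`, then `x` depends boundedly on any
splitting of `(I - T) x` along the `M_i^⊥`. -/
theorem exists_norm_le_of_sumPerp_le (M : Fin m → ClosedSubmodule ℝ H)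
    (h : sumPerp M ≤ rangePow M 1) :
    ∃ B : ℝ, 0 ≤ B ∧ ∀ (u : ∀ i, (M i).toSubmoduleᗮ), ∀ x ∈ (inter M).toSubmoduleᗮ,
      x - T M x = ∑ i, (u i : H) → ‖x‖ ≤ B * ‖u‖ := by
  have inj : ∀ x ∈ (inter M).toSubmoduleᗮ, ∀ x' ∈ (inter M).toSubmoduleᗮ,
      x - T M x = x' - T M x' → x = x' := by
    intro x hx x' hx' he
    refine sub_eq_zero.1 (mem_inter_of_one_sub_T_pow_eq_zero M 1 _ (Submodule.sub_mem _ hx hx') ?_)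
    simp only [pow_one, map_sub, sub_apply, one_apply_eq_self]
    rw [he, sub_self]
  have ex : ∀ u : ∀ i, (M i).toSubmoduleᗮ,
      ∃ x : (inter M).toSubmoduleᗮ, (x : H) - T M x = ∑ i, (u i : H) := by
    intro u
    obtain ⟨x, hx⟩ := (mem_rangePow_one M).1
      (h (Submodule.sum_mem _ fun i _ => Submodule.mem_iSup_of_mem i (u i).2))
    -- T fixes P_M x, so subtracting it leaves (I - T)x unchanged.
    refine ⟨⟨x - proj (inter M) x, sub_proj_mem_orthogonal _ _⟩, ?_⟩
    have hP : T M (proj (inter M) x) = proj (inter M) x :=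
      (T_apply_eq_self_iff M).2 (Submodule.starProjection_apply_mem _ x)
    simp only [map_sub, hP]
    rw [← hx]
    abel
  choose f hf using ex
  have uniq : ∀ (u : ∀ i, (M i).toSubmoduleᗮ) (x : (inter M).toSubmoduleᗮ),
      (x : H) - T M x = ∑ i, (u i : H) → x = f u := fun u x hx =>
    Subtype.ext (inj _ x.2 _ (f u).2 (hx.trans (hf u).symm))
  let g : (∀ i, (M i).toSubmoduleᗮ) →ₗ[ℝ] (inter M).toSubmoduleᗮ :=
    { toFun := f
      map_add' := fun u v => (uniq _ _ (by
        simp only [Submodule.coe_add, map_add, Pi.add_apply, Finset.sum_add_distrib, ← hf]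
        abel)).symm
      map_smul' := fun c u => (uniq _ _ (by
        simp only [Submodule.coe_smul, map_smul, Pi.smul_apply, ← Finset.smul_sum, ← hf,
          RingHom.id_apply, smul_sub])).symm }
  have hg : Continuous g := by
    -- The equation defining `f` is continuous in both variables, so it survives limits; uniqueness
    -- closes the graph.
    refine g.continuous_of_seq_closed_graph fun v u x hv hx => uniq u x ?_
    have h1 : Tendsto (fun n => (f (v n) : H) - T M (f (v n))) atTop (nhds ((x : H) - T M x)) := by
      have hc : Continuous fun z : (inter M).toSubmoduleᗮ => (z : H) - T M z := by fun_prop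
      exact (hc.tendsto x).comp hx
    have h2 : Tendsto (fun n => ∑ i, (v n i : H)) atTop (nhds (∑ i, (u i : H))) := by
      have hc : Continuous fun w : (∀ i, (M i).toSubmoduleᗮ) => ∑ i, (w i : H) := by fun_prop
      exact (hc.tendsto u).comp hv
    simp only [hf] at h1
    exact tendsto_nhds_unique h1 h2
  let G : (∀ i, (M i).toSubmoduleᗮ) →L[ℝ] (inter M).toSubmoduleᗮ := ⟨g, hg⟩
  refine ⟨‖G‖, G.opNorm_nonneg, fun u x hx hu => ?_⟩
  have := G.le_opNorm u
  rwa [show G u = ⟨x, hx⟩ from (uniq u ⟨x, hx⟩ hu).symm] at this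

theorem orthogonal_le_of_sumPerp_le (M : Fin m → ClosedSubmodule ℝ H)
    (h : sumPerp M ≤ rangePow M 1) : (inter M).toSubmoduleᗮ ≤ rangePow M 1 := by
  obtain ⟨B, hB, hle⟩ := exists_norm_le_of_sumPerp_le M h
  obtain ⟨C, hC, hsplit⟩ := exists_sum_eq_sub_listProj M (List.finRange m).reverse
  rw [← T_eq_listProj] at hsplit
  -- The summand 1 ensures D ≥ 1, so the contraction factor √(1 - 1/D) is a genuine root.
  set D := B ^ 2 * C + 1 with hD
  have hD1 : 1 ≤ D := by
    have : 0 ≤ B ^ 2 * C := by positivity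
    linarith
  have hcontr : ∀ x ∈ (inter M).toSubmoduleᗮ, ‖T M x‖ ≤ √(1 - D⁻¹) * ‖x‖ := by
    intro x hx
    obtain ⟨u, hu, hn⟩ := hsplit x
    have h1 := hle u x hx hu
    have h2 : ‖x‖ ^ 2 ≤ D * (‖x‖ ^ 2 - ‖T M x‖ ^ 2) := by
      have h3 : ‖x‖ ^ 2 ≤ B ^ 2 * ‖u‖ ^ 2 := by
        rw [← mul_pow]
        gcongr
      have h4 : B ^ 2 * ‖u‖ ^ 2 ≤ B ^ 2 * (C * (‖x‖ ^ 2 - ‖T M x‖ ^ 2)) := by gcongr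
      have h5 : ‖T M x‖ ^ 2 ≤ ‖x‖ ^ 2 := by
        gcongr
        simpa using norm_T_pow_le M 1 x
      rw [hD]
      linarith
    have h6 : D⁻¹ * ‖x‖ ^ 2 ≤ ‖x‖ ^ 2 - ‖T M x‖ ^ 2 := by
      rw [inv_mul_le_iff₀ (by positivity)]
      exact h2
    refine le_of_sq_le_sq ?_ (by positivity)
    rw [mul_pow, Real.sq_sqrt (sub_nonneg.2 (inv_le_one_of_one_le₀ hD1))]
    linarith
  refine orthogonal_le_rangePow_one M (k := 1)
    ((ContinuousLinearMap.opNorm_le_bound _ (Real.sqrt_nonneg (1 - D⁻¹)) fun x => ?_).trans_lt ?_)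
  · simp only [pow_one, mul_apply_eq_comp, sub_apply, one_apply_eq_self]
    refine (hcontr _ (sub_proj_mem_orthogonal _ x)).trans ?_
    gcongr
    refine le_of_sq_le_sq ?_ (norm_nonneg x)
    rw [norm_sq_sub_norm_sq_proj]
    linarith [sq_nonneg ‖proj (inter M) x‖]
  · rw [Real.sqrt_lt' one_pos]
    have : 0 < D⁻¹ := by positivity
    linarith

theorem X_one_lt_Y (M : Fin m → ClosedSubmodule ℝ H) (hM : ¬ IsClosed (sumPerp M : Set H)) :
    X M 1 < Y M := by
  refine lt_of_le_not_ge (sup_le_sup_left (rangePow_one_le_sumPerp M) _) fun hle => hM ?_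
  refine isClosed_sumPerp_of_orthogonal_le M (orthogonal_le_of_sumPerp_le M fun x hx => ?_)
  exact mem_of_mem_sup_of_mem_orthogonal M (rangePow_le_orthogonal M le_rfl)
    (hle (Submodule.mem_sup_right hx)) (sumPerp_le_orthogonal M hx)

theorem X_lt_Y (M : Fin m → ClosedSubmodule ℝ H) (hM : ¬ IsClosed (sumPerp M : Set H))
    {p : ℕ} (hp : 1 ≤ p) : X M p < Y M :=
  (antitone_nat_of_succ_le (X_succ_le M) hp).trans_lt (X_one_lt_Y M hM)

/-! ### Polynomial rates -/

/-- A telescoping majorant for the tails of ∑ (k+1)^{-(t+1)}. The factor 2^{t+1} comes from k + 2 ≤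
2(k + 1), the factor 1/t from ((k+2)/(k+1))^t ≥ 1 + t/(k+2). -/
theorem rpow_neg_le_mul_sub {t : ℝ} (ht : 0 < t) (k : ℕ) :
    ((k : ℝ) + 1) ^ (-(t + 1)) ≤
      2 ^ (t + 1) / t * (((k : ℝ) + 1) ^ (-t) - ((k : ℝ) + 2) ^ (-t)) := by
  have h1 : (0 : ℝ) < (k : ℝ) + 1 := by positivity
  have h2 : (0 : ℝ) < (k : ℝ) + 2 := by positivity
  have hA : ((k : ℝ) + 1) ^ (-(t + 1)) ≤ 2 ^ (t + 1) * ((k : ℝ) + 2) ^ (-(t + 1)) := by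
    rw [Real.rpow_neg h1.le, Real.rpow_neg h2.le, ← div_eq_mul_inv, inv_eq_one_div,
      div_le_div_iff₀ (by positivity) (by positivity), one_mul,
      ← Real.mul_rpow (by norm_num) h1.le]
    exact Real.rpow_le_rpow h2.le (by linarith [(Nat.cast_nonneg k : (0 : ℝ) ≤ k)])
      (by linarith)
  have hB : t * ((k : ℝ) + 2) ^ (-(t + 1)) ≤ ((k : ℝ) + 1) ^ (-t) - ((k : ℝ) + 2) ^ (-t) := by
    have hlog : 1 / ((k : ℝ) + 2) ≤ Real.log (((k : ℝ) + 2) / (k + 1)) := by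
      refine le_trans (le_of_eq ?_) (Real.one_sub_inv_le_log_of_pos (by positivity))
      field_simp
      ring
    have hexp : 1 + t / ((k : ℝ) + 2) ≤ (((k : ℝ) + 2) / (k + 1)) ^ t := by
      rw [Real.rpow_def_of_pos (by positivity)]
      have := Real.add_one_le_exp (Real.log (((k : ℝ) + 2) / (k + 1)) * t)
      have h3 : 1 / ((k : ℝ) + 2) * t ≤ Real.log (((k : ℝ) + 2) / (k + 1)) * t := by gcongr
      rw [one_div_mul_eq_div] at h3
      linarith
    have h4 : ((k : ℝ) + 1) ^ (-t) = (((k : ℝ) + 2) / (k + 1)) ^ t * ((k : ℝ) + 2) ^ (-t) := by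
      rw [Real.div_rpow h2.le h1.le, Real.rpow_neg h1.le, Real.rpow_neg h2.le]
      have := (Real.rpow_pos_of_pos h2 t).ne'
      field_simp
    have h5 : ((k : ℝ) + 2) ^ (-(t + 1)) = ((k : ℝ) + 2) ^ (-t) / ((k : ℝ) + 2) := by
      rw [neg_add', Real.rpow_sub_one h2.ne']
    have h6 := mul_le_mul_of_nonneg_right hexp (Real.rpow_nonneg h2.le (-t))
    rw [h4, h5]
    calc t * (((k : ℝ) + 2) ^ (-t) / ((k : ℝ) + 2))
        = (1 + t / ((k : ℝ) + 2)) * ((k : ℝ) + 2) ^ (-t) - ((k : ℝ) + 2) ^ (-t) := by ring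
      _ ≤ _ := by linarith
  calc ((k : ℝ) + 1) ^ (-(t + 1)) ≤ 2 ^ (t + 1) * ((k : ℝ) + 2) ^ (-(t + 1)) := hA
    _ = 2 ^ (t + 1) / t * (t * ((k : ℝ) + 2) ^ (-(t + 1))) := by field_simp
    _ ≤ _ := by gcongr

/-- A polynomial rate for `T^k (I - T) z` improves to a rate for `T^k z`, with one degree lost. -/
theorem exists_norm_T_pow_le (M : Fin m → ClosedSubmodule ℝ H) {t C : ℝ} (ht : 0 < t) {z : H}
    (hz : z ∈ (inter M).toSubmoduleᗮ)
    (h : ∀ k : ℕ, ‖(T M ^ k) ((1 - T M) z)‖ ≤ C * ((k : ℝ) + 1) ^ (-(t + 1))) :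
    ∃ C' : ℝ, ∀ k : ℕ, ‖(T M ^ k) z‖ ≤ C' * ((k : ℝ) + 1) ^ (-t) := by
  let a : ℕ → H := fun k => (T M ^ k) z
  let b : ℕ → ℝ := fun k => ((k : ℝ) + 1) ^ (-t)
  have hC : 0 ≤ C := by
    have := (norm_nonneg _).trans (h 0)
    simpa using this
  let D : ℝ := C * (2 ^ (t + 1) / t)
  have hD : 0 ≤ D := by positivity
  have hb : ∀ k, 0 ≤ b k := fun k => by positivity
  have hstep : ∀ k, dist (a k) (a (k + 1)) ≤ D * (b k - b (k + 1)) := by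
    intro k
    have h1 : a k - a (k + 1) = (T M ^ k) ((1 - T M) z) := by
      simp [a]
    rw [dist_eq_norm, h1]
    refine (h k).trans ((mul_le_mul_of_nonneg_left (rpow_neg_le_mul_sub ht k) hC).trans_eq ?_)
    simp only [D, b]
    push_cast
    rw [mul_assoc, add_assoc, one_add_one_eq_two]
  have hdist : ∀ k n, k ≤ n → dist (a k) (a n) ≤ D * b k := by
    intro k n hkn
    have h1 : dist (a k) (a n) ≤ D * (b k - b n) := by
      induction n, hkn using Nat.le_induction with
      | base => simp
      | succ n _ ih =>
        refine (dist_triangle _ (a n) _).trans ((add_le_add ih (hstep n)).trans_eq ?_)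
        ring
    exact h1.trans (mul_le_mul_of_nonneg_left (sub_le_self _ (hb n)) hD)
  have hlim : Tendsto b atTop (nhds 0) :=
    (tendsto_rpow_neg_atTop ht).comp
      (tendsto_atTop_add_const_right _ 1 tendsto_natCast_atTop_atTop)
  obtain ⟨L, hL⟩ := cauchySeq_tendsto_of_complete
    (cauchySeq_of_le_tendsto_0' (s := a) (fun k => D * b k) hdist
      (by simpa using hlim.const_mul D))
  -- The limit is fixed by T, hence in M, and it lies in the closed subspace M^⊥.
  have hL0 : L = 0 := by
    refine eq_zero_of_mem_inter_of_mem_orthogonal M ((T_apply_eq_self_iff M).1 ?_)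
      ((Submodule.isClosed_orthogonal _).mem_of_tendsto hL
        (Eventually.of_forall fun k => T_pow_mem_orthogonal M k hz))
    have h1 := ((T M).continuous.tendsto L).comp hL
    refine tendsto_nhds_unique h1 ?_
    refine (hL.comp (tendsto_add_atTop_nat 1)).congr fun k => ?_
    simp only [a, Function.comp_apply, pow_succ', mul_apply_eq_comp]
  refine ⟨D, fun k => ?_⟩
  have h1 : Tendsto (fun n => dist (a k) (a n)) atTop (nhds (dist (a k) L)) :=
    tendsto_const_nhds.dist hL
  have h2 := le_of_tendsto h1 (eventually_atTop.2 ⟨k, fun n hn => hdist k n hn⟩)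
  rwa [hL0, dist_zero_right] at h2

theorem exists_norm_T_pow_le_of_pow (M : Fin m → ClosedSubmodule ℝ H) {ε : ℝ} (hε : 0 < ε) (p : ℕ)
    {z : H} (hz : z ∈ (inter M).toSubmoduleᗮ) {C : ℝ}
    (h : ∀ k : ℕ, ‖(T M ^ k) (((1 - T M) ^ p) z)‖ ≤ C * ((k : ℝ) + 1) ^ (-((p : ℝ) + ε))) :
    ∃ C' : ℝ, ∀ k : ℕ, ‖(T M ^ k) z‖ ≤ C' * ((k : ℝ) + 1) ^ (-ε) := by
  induction p generalizing C with
  | zero => exact ⟨C, by simpa using h⟩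
  | succ p ih =>
    have hmem : ((1 - T M) ^ p) z ∈ (inter M).toSubmoduleᗮ := by
      rcases Nat.eq_zero_or_pos p with rfl | hp
      · simpa
      · exact rangePow_le_orthogonal M hp ⟨z, rfl⟩
    obtain ⟨C', hC'⟩ := exists_norm_T_pow_le M (t := p + ε) (C := C) (by positivity) hmem
      (fun k => by
        have h1 := h k
        rw [pow_succ', mul_apply_eq_comp] at h1
        convert h1 using 4
        push_cast
        ring)
    exact ih hC'

/-- The shift to k + 1 keeps the comparison function nonzero at k = 0, so that an eventual bound
extends to all k. -/
theorem exists_bound_of_isLittleO {a : ℕ → ℝ} {s : ℝ} (hs : 0 < s)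
    (h : a =o[atTop] fun k : ℕ => (k : ℝ) ^ (-s)) :
    ∃ C : ℝ, ∀ k : ℕ, ‖a k‖ ≤ C * ((k : ℝ) + 1) ^ (-s) := by
  have h1 : (fun k : ℕ => (k : ℝ) ^ (-s)) =O[atTop] fun k : ℕ => ((k : ℝ) + 1) ^ (-s) := by
    refine IsBigO.of_bound (2 ^ s) (eventually_atTop.2 ⟨1, fun k hk => ?_⟩)
    have hk' : (1 : ℝ) ≤ k := by exact_mod_cast hk
    have hk0 : (0 : ℝ) < k := by linarith
    rw [Real.norm_of_nonneg (by positivity), Real.norm_of_nonneg (by positivity),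
      Real.rpow_neg hk0.le, Real.rpow_neg (by positivity), ← div_eq_mul_inv, inv_eq_one_div,
      div_le_div_iff₀ (by positivity) (by positivity), one_mul,
      ← Real.mul_rpow (by norm_num) hk0.le]
    exact Real.rpow_le_rpow (by positivity) (by linarith) hs.le
  have hO := h.isBigO.trans h1
  rw [← Nat.cofinite_eq_atTop] at hO
  obtain ⟨C, -, hC⟩ := bound_of_isBigO_cofinite hO
  refine ⟨C, fun k => ?_⟩
  have hpos : (0 : ℝ) < ((k : ℝ) + 1) ^ (-s) := by positivity
  simpa [Real.norm_of_nonneg hpos.le] using hC hpos.ne'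

/-- Banach–Steinhaus for (k+1)^ε T^k (I - P_M) makes the constant independent of z; once (k+1)^ε
exceeds it, T^k (I - P_M) has norm below 1. -/
theorem isClosed_sumPerp_of_rate (M : Fin m → ClosedSubmodule ℝ H) {ε : ℝ} (hε : 0 < ε)
    (h : ∀ z ∈ (inter M).toSubmoduleᗮ,
      ∃ C : ℝ, ∀ k : ℕ, ‖(T M ^ k) z‖ ≤ C * ((k : ℝ) + 1) ^ (-ε)) :
    IsClosed (sumPerp M : Set H) := by
  let g : ℕ → H →L[ℝ] H := fun k => ((k : ℝ) + 1) ^ ε • (T M ^ k * (1 - proj (inter M)))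
  have hpos : ∀ k : ℕ, (0 : ℝ) < ((k : ℝ) + 1) ^ ε := fun k => by positivity
  obtain ⟨C, hC⟩ := banach_steinhaus (g := g) fun x => by
    obtain ⟨C, hC⟩ := h (x - proj (inter M) x) (sub_proj_mem_orthogonal _ x)
    refine ⟨C, fun k => ?_⟩
    have h1 := hC k
    rw [Real.rpow_neg (by positivity), ← div_eq_mul_inv, le_div_iff₀ (hpos k)] at h1
    have h2 : g k x = ((k : ℝ) + 1) ^ ε • (T M ^ k) (x - proj (inter M) x) := by simp [g]
    rw [h2, norm_smul, Real.norm_of_nonneg (hpos k).le, mul_comm]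
    exact h1
  have hlim : Tendsto (fun k : ℕ => ((k : ℝ) + 1) ^ ε) atTop atTop :=
    (tendsto_rpow_atTop hε).comp (tendsto_atTop_add_const_right _ 1 tendsto_natCast_atTop_atTop)
  obtain ⟨k, hk⟩ := (hlim.eventually_gt_atTop C).exists
  refine isClosed_sumPerp_of_orthogonal_le M (orthogonal_le_rangePow_one M (k := k) ?_)
  have h1 := hC k
  rw [norm_smul, Real.norm_of_nonneg (hpos k).le] at h1
  exact lt_of_mul_lt_mul_left (by linarith) (hpos k).le

theorem not_isLittleO_rate (M : Fin m → ClosedSubmodule ℝ H)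
    (hM : ¬ IsClosed (sumPerp M : Set H)) {p : ℕ} (hp : 1 ≤ p) {ε : ℝ} (hε : 0 < ε) :
    ¬ ∀ y₀ ∈ X M p, (fun k : ℕ => ‖iter M y₀ k - proj (inter M) y₀‖)
      =o[atTop] fun k : ℕ => (k : ℝ) ^ (-((p : ℝ) + ε)) := by
  intro h
  refine hM (isClosed_sumPerp_of_rate M hε fun z hz => ?_)
  have hmem : ((1 - T M) ^ p) z ∈ rangePow M p := ⟨z, rfl⟩
  obtain ⟨C, hC⟩ := exists_bound_of_isLittleO (by positivity) (h _ (Submodule.mem_sup_right hmem))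
  refine exists_norm_T_pow_le_of_pow M hε p hz (C := C) fun k => ?_
  have h1 := hC k
  rwa [proj_inter_eq_zero M (rangePow_le_orthogonal M hp hmem), sub_zero, norm_norm] at h1

end CyclicProjections

theorem corollary4p4 {H : Type*} [NormedAddCommGroup H] [InnerProductSpace ℝ H] [CompleteSpace H]
    {m : ℕ} (M : Fin m → ClosedSubmodule ℝ H)
    (hM : ¬ IsClosed (CyclicProjections.sumPerp M : Set H)) :
    (∀ p : ℕ, 1 ≤ p → ∀ ε : ℝ, 0 < ε →
      ¬ ∀ y₀ ∈ CyclicProjections.X M p,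
        (fun k : ℕ => ‖CyclicProjections.iter M y₀ k -
            CyclicProjections.proj (CyclicProjections.inter M) y₀‖)
          =o[atTop] fun k : ℕ => (k : ℝ) ^ (-((p : ℝ) + ε))) ∧
    (∀ p : ℕ, 1 ≤ p →
      CyclicProjections.X M (p + 1) < CyclicProjections.X M p ∧
      CyclicProjections.X M p < CyclicProjections.Y M) := by
  exact ⟨fun p hp ε hε => CyclicProjections.not_isLittleO_rate M hM hp hε,
    fun p hp => ⟨CyclicProjections.X_succ_lt M hM hp, CyclicProjections.X_lt_Y M hM hp⟩⟩
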